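/- Let $\mathbf{k}$ be an algebraically closed field and let $F_4$ be the free group on four generators, so that a representation $\rho\colon F_4\to \mathrm{SL}_2(\mathbf{k})$ is a quadruple $(A,B,C,D)$ of matrices in $\mathrm{SL}_2(\mathbf{k})$. Let $\mathfrak{X}_4=\mathfrak{X}(F_4,\mathrm{SL}_2)$ be the character variety, i.e. the set of all characters $\chi_\rho\colon F_4\to\mathbf{k}$, $\chi_\rho(g)=\mathrm{tr}\,\rho(g)$, with coordinate ring $\mathcal{O}_{\mathfrak{X}_4}$ the $\mathbf{k}$-algebra of functions generated by the traces $\chi_\rho\mapsto\chi_\rho(g)$, $g\in F_4$. For a word $W$ in $A,B,C,D$ write $t_W=\mathrm{tr}(W)\in\mathcal{O}_{\mathfrak{X}_4}$, and put $$S=\mathbf{k}[t_A,t_B,t_C,t_D,t_{AB},t_{AC},t_{BC},t_{AD},t_{BD}]\subset\mathcal{O}_{\mathfrak{X}_4}.$$ Then $t_{CD}$ is algebraic over $S$. Moreover, the nine traces $t_A,t_B,t_C,t_D,t_{AB},t_{AC},t_{BC},t_{AD},t_{BD}$ are transcendental generators of $\mathcal{O}_{\mathfrak{X}_4}$: they are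 algebraically independent over $\mathbf{k}$, and every element of $\mathcal{O}_{\mathfrak{X}_4}$ is algebraic over $S$. The same statements hold when $\mathfrak{X}_4$ is taken to be the GIT quotient $(\mathrm{SL}_2)^4/\!/\mathrm{SL}_2$, that is, when $\mathcal{O}_{\mathfrak{X}_4}$ is replaced by the ring of regular functions on $(\mathrm{SL}_2)^4$ that are invariant under simultaneous conjugation by $\mathrm{SL}_2(\mathbf{k})$. -/

import Mathlib

open scoped MatrixGroups

noncomputable section

namespace SL2CharVar

/-- The representations `R(Γ, SL₂)` of a group `Γ` in `SL₂(K)`. For `Γ` free on `k` letters these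
are the `k`-tuples of matrices in `SL₂(K)`. -/
abbrev Rep (Γ K : Type*) [Group Γ] [Field K] := Γ →* SL(2, K)

/-- The character `g ↦ tr (ρ g)` of a representation. -/
def character {Γ K : Type*} [Group Γ] [Field K] (ρ : Rep Γ K) : Γ → K :=
  fun g => Matrix.trace (ρ g : Matrix (Fin 2) (Fin 2) K)

/-- The character variety `X(Γ, SL₂)`: the set of all characters of representations. -/
def charVariety (Γ K : Type*) [Group Γ] [Field K] : Set (Γ → K) :=
  Set.range (character : Rep Γ K → Γ → K)

/-- The coordinate ring of `X(Γ, SL₂)`: the functions on the character variety that are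
polynomials in the evaluations `χ ↦ χ g`, `g : Γ`. -/
def coordRing (Γ K : Type*) [Group Γ] [Field K] : Subalgebra K (charVariety Γ K → K) :=
  Algebra.adjoin K (Set.range fun (g : Γ) (χ : charVariety Γ K) => χ.1 g)

/-- The trace `t_g` of `g : Γ`, as a regular function on the character variety. -/
def tr {Γ : Type*} (K : Type*) [Group Γ] [Field K] (g : Γ) : coordRing Γ K :=
  ⟨fun χ => χ.1 g, Algebra.subset_adjoin ⟨g, rfl⟩⟩

/-- The coordinate ring of the affine algebraic set `R(Γ, SL₂)`: the functions of `ρ` that are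
polynomials in the entries of the matrices `ρ g`, `g : Γ`. -/
def repRing (Γ K : Type*) [Group Γ] [Field K] : Subalgebra K (Rep Γ K → K) :=
  Algebra.adjoin K (Set.range fun (x : Γ × Fin 2 × Fin 2) (ρ : Rep Γ K) =>
    (ρ x.1 : Matrix (Fin 2) (Fin 2) K) x.2.1 x.2.2)

/-- The representation `g ↦ P * ρ g * P⁻¹`. -/
def conjRep {Γ K : Type*} [Group Γ] [Field K] (P : SL(2, K)) (ρ : Rep Γ K) : Rep Γ K :=
  (MulAut.conj P).toMonoidHom.comp ρ

/-- The coordinate ring of the GIT quotient `R(Γ, SL₂) // SL₂`: the regular functions on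
`R(Γ, SL₂)` that are invariant under conjugation by `SL₂`. -/
def invRing (Γ K : Type*) [Group Γ] [Field K] : Subalgebra K (Rep Γ K → K) where
  carrier := {f | f ∈ repRing Γ K ∧ ∀ (P : SL(2, K)) (ρ : Rep Γ K), f (conjRep P ρ) = f ρ}
  mul_mem' := fun {f g} hf hg =>
    ⟨mul_mem hf.1 hg.1, fun P ρ => by simp only [Pi.mul_apply, hf.2 P ρ, hg.2 P ρ]⟩
  add_mem' := fun {f g} hf hg =>
    ⟨add_mem hf.1 hg.1, fun P ρ => by simp only [Pi.add_apply, hf.2 P ρ, hg.2 P ρ]⟩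
  algebraMap_mem' := fun c => ⟨Subalgebra.algebraMap_mem _ c, fun _ _ => rfl⟩

theorem character_mem_invRing {Γ : Type*} (K : Type*) [Group Γ] [Field K] (g : Γ) :
    (fun ρ : Rep Γ K => character ρ g) ∈ invRing Γ K := by
  refine ⟨?_, fun P ρ => ?_⟩
  · have h : (fun ρ : Rep Γ K => character ρ g) =
        (fun ρ : Rep Γ K => (ρ g : Matrix (Fin 2) (Fin 2) K) 0 0) +
        (fun ρ : Rep Γ K => (ρ g : Matrix (Fin 2) (Fin 2) K) 1 1) := by
      funext ρ
      simp [character, Matrix.trace_fin_two]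
    rw [h]
    exact add_mem (Algebra.subset_adjoin ⟨(g, 0, 0), rfl⟩)
      (Algebra.subset_adjoin ⟨(g, 1, 1), rfl⟩)
  · have h : ((P⁻¹ : SL(2, K)) : Matrix (Fin 2) (Fin 2) K) * (P : Matrix (Fin 2) (Fin 2) K) = 1 := by
      rw [← Matrix.SpecialLinearGroup.coe_mul, inv_mul_cancel, Matrix.SpecialLinearGroup.coe_one]
    change Matrix.trace ((P * ρ g * P⁻¹ : SL(2, K)) : Matrix (Fin 2) (Fin 2) K) =
      Matrix.trace (ρ g : Matrix (Fin 2) (Fin 2) K)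
    rw [Matrix.SpecialLinearGroup.coe_mul, Matrix.SpecialLinearGroup.coe_mul,
      Matrix.trace_mul_comm, ← Matrix.mul_assoc, h, Matrix.one_mul]

/-- The trace `ρ ↦ tr (ρ g)`, as a regular function on the GIT quotient. -/
def trInv {Γ : Type*} (K : Type*) [Group Γ] [Field K] (g : Γ) : invRing Γ K :=
  ⟨fun ρ => character ρ g, character_mem_invRing K g⟩

/-- The free generators of `F₄`; a representation sends them to the matrices `A, B, C, D`. -/
def a : FreeGroup (Fin 4) := FreeGroup.of 0
def b : FreeGroup (Fin 4) := FreeGroup.of 1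
def c : FreeGroup (Fin 4) := FreeGroup.of 2
def d : FreeGroup (Fin 4) := FreeGroup.of 3

/-- The nine words `A, B, C, D, AB, AC, BC, AD, BD`. -/
def nine : Fin 9 → FreeGroup (Fin 4) :=
  ![a, b, c, d, a * b, a * c, b * c, a * d, b * d]

end SL2CharVar

end

namespace SL2CharVar

open MvPolynomial

variable {K : Type*} [Field K]

/-! Everything happens where δ = tr [A, B] - 2 is nonzero. There A and B share no eigenvector, and
simultaneous conjugation makes A a companion matrix and B upper triangular
(`exists_conjRep_isNormal`).

Independence: every nine values with δ ≠ 0 are traces of a normal representation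
(`exists_normalRep`), so a polynomial relation p between the traces gives p δ = 0 as a function on
K⁹, hence p = 0.

Algebraicity: in normal form the entries of A and B are algebraic over the polynomial ring in the
nine traces. For g = C or D, tr (ABg) is a root of the monic Fricke quadratic, whose coefficients
are polynomials in the nine traces, and Cramer's rule with determinant δ recovers g from the traces
of g, Ag, Bg, ABg (`cramer_trace`). So all matrix entries of all words, and with them all regular
functions, are algebraic on normal representations. Multiplying an annihilating polynomial by δ
makes it valid also where δ = 0 (`isAlgebraic_adjoin_of_restrict`), for characters and for
invariants alike. -/

theorem exists_quadratic_root [IsAlgClosed K] {α : K} (hα : α ≠ 0) (β γ : K) :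
    ∃ s : K, α * s ^ 2 + β * s + γ = 0 := by
  obtain ⟨s, hs⟩ := IsAlgClosed.exists_root
    (Polynomial.C α * Polynomial.X ^ 2 + Polynomial.C β * Polynomial.X + Polynomial.C γ)
    (by rw [Polynomial.degree_quadratic hα]; norm_num)
  exact ⟨s, by simpa [Polynomial.IsRoot] using hs⟩

/-! ### The discriminant and the normal form. -/

/-- The determinant of the trace form on the basis `1, A, B, AB`, up to sign: it equals
`tr [A, B] - 2`, as a polynomial in `tr A, tr B, tr (AB)`. -/
noncomputable def discr (K : Type*) [Field K] : MvPolynomial (Fin 9) K :=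
  X 0 ^ 2 + X 1 ^ 2 + X 4 ^ 2 - X 0 * X 1 * X 4 - C 4

theorem aeval_discr {E : Type*} [CommRing E] [Algebra K E] (t : Fin 9 → E) :
    aeval t (discr K) = t 0 ^ 2 + t 1 ^ 2 + t 4 ^ 2 - t 0 * t 1 * t 4 - 4 := by
  simp [discr, map_ofNat]

theorem eval_discr (t : Fin 9 → K) :
    eval t (discr K) = t 0 ^ 2 + t 1 ^ 2 + t 4 ^ 2 - t 0 * t 1 * t 4 - 4 := by
  simp [discr]

theorem discr_ne_zero : discr K ≠ 0 := fun h => by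
  -- At this point the discriminant is 1, hence nonzero in every characteristic.
  have := congrArg (eval (![0, 2, 0, 0, 1, 0, 0, 0, 0] : Fin 9 → K)) h
  rw [eval_discr] at this
  simp at this
  norm_num at this

/-- The nine traces of a representation of the free group. -/
def nineTraces (ρ : Rep (FreeGroup (Fin 4)) K) : Fin 9 → K := fun i => character ρ (nine i)

/-- The representations for which `A` is a companion matrix, `B` is upper triangular, and
`A, B` have no common eigenvector. -/
structure IsNormal (ρ : Rep (FreeGroup (Fin 4)) K) : Prop where
  a00 : ρ a 0 0 = 0
  a01 : ρ a 0 1 = -1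
  a10 : ρ a 1 0 = 1
  b10 : ρ b 1 0 = 0
  discr_ne : eval (nineTraces ρ) (discr K) ≠ 0

abbrev NormalRep (K : Type*) [Field K] := {ρ : Rep (FreeGroup (Fin 4)) K // IsNormal ρ}

theorem det_entries (g : SL(2, K)) : g 0 0 * g 1 1 - g 0 1 * g 1 0 = 1 := by
  rw [← Matrix.det_fin_two]; exact g.2

theorem character_conjRep {Γ : Type*} [Group Γ] (P : SL(2, K)) (ρ : Rep Γ K) :
    character (conjRep P ρ) = character ρ :=
  funext fun g => (character_mem_invRing K g).2 P ρ

theorem nineTraces_apply (ρ : Rep (FreeGroup (Fin 4)) K) :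
    nineTraces ρ 0 = ρ a 0 0 + ρ a 1 1 ∧ nineTraces ρ 1 = ρ b 0 0 + ρ b 1 1 ∧
    nineTraces ρ 2 = ρ c 0 0 + ρ c 1 1 ∧ nineTraces ρ 3 = ρ d 0 0 + ρ d 1 1 ∧
    nineTraces ρ 4 = ρ a 0 0 * ρ b 0 0 + ρ a 0 1 * ρ b 1 0 +
      (ρ a 1 0 * ρ b 0 1 + ρ a 1 1 * ρ b 1 1) ∧
    nineTraces ρ 5 = ρ a 0 0 * ρ c 0 0 + ρ a 0 1 * ρ c 1 0 +
      (ρ a 1 0 * ρ c 0 1 + ρ a 1 1 * ρ c 1 1) ∧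
    nineTraces ρ 6 = ρ b 0 0 * ρ c 0 0 + ρ b 0 1 * ρ c 1 0 +
      (ρ b 1 0 * ρ c 0 1 + ρ b 1 1 * ρ c 1 1) ∧
    nineTraces ρ 7 = ρ a 0 0 * ρ d 0 0 + ρ a 0 1 * ρ d 1 0 +
      (ρ a 1 0 * ρ d 0 1 + ρ a 1 1 * ρ d 1 1) ∧
    nineTraces ρ 8 = ρ b 0 0 * ρ d 0 0 + ρ b 0 1 * ρ d 1 0 +
      (ρ b 1 0 * ρ d 0 1 + ρ b 1 1 * ρ d 1 1) := by
  simp [nineTraces, character, nine, Matrix.trace_fin_two, Matrix.mul_apply, Fin.sum_univ_two]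

theorem coe_conjRep {Γ : Type*} [Group Γ] (P : SL(2, K)) (ρ : Rep Γ K) (g : Γ) :
    (conjRep P ρ g : Matrix (Fin 2) (Fin 2) K) = P * ρ g * (P⁻¹ : SL(2, K)) := rfl

/-- Take an eigenvector v of B and w = Av. In the basis v, w the matrix B is upper triangular, and A
is a companion matrix by Cayley–Hamilton. -/
theorem exists_conjRep_isNormal [IsAlgClosed K] (ρ : Rep (FreeGroup (Fin 4)) K)
    (hρ : eval (nineTraces ρ) (discr K) ≠ 0) : ∃ P, IsNormal (conjRep P ρ) := by
  obtain ⟨h0, h1, -, -, h4, -⟩ := nineTraces_apply ρ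
  have hA := det_entries (ρ a)
  have hB := det_entries (ρ b)
  obtain ⟨μ, hμ⟩ := exists_quadratic_root (one_ne_zero (α := K)) (-(ρ b 0 0 + ρ b 1 1)) 1
  obtain ⟨v, hv0, hv⟩ := Matrix.exists_mulVec_eq_zero_iff (M := !![ρ b 0 0 - μ, ρ b 0 1;
    ρ b 1 0, ρ b 1 1 - μ]).2 (by rw [Matrix.det_fin_two_of]; linear_combination hB + hμ)
  have e0 : (ρ b 0 0 - μ) * v 0 + ρ b 0 1 * v 1 = 0 := by
    simpa [Matrix.mulVec, dotProduct, Fin.sum_univ_two] using congrFun hv 0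
  have e1 : ρ b 1 0 * v 0 + (ρ b 1 1 - μ) * v 1 = 0 := by
    simpa [Matrix.mulVec, dotProduct, Fin.sum_univ_two] using congrFun hv 1
  set w0 := ρ a 0 0 * v 0 + ρ a 0 1 * v 1 with hw0
  set w1 := ρ a 1 0 * v 0 + ρ a 1 1 * v 1 with hw1
  have hdet : v 0 * w1 - w0 * v 1 ≠ 0 := by
    intro h
    apply hρ
    rw [eval_discr, h0, h1, h4]
    -- If v and w were dependent, v would be a common eigenvector, so AB - BA would kill it; but det
    -- (AB - BA) = -δ.
    obtain ⟨l, hl0, hl1⟩ : ∃ l, w0 = l * v 0 ∧ w1 = l * v 1 := by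
      by_cases hv1 : v 0 = 0
      · have hv2 : v 1 ≠ 0 := fun hc => hv0 (funext fun i => by fin_cases i <;> simp [hv1, hc])
        refine ⟨w1 / v 1, ?_, by field_simp⟩
        field_simp
        linear_combination -h
      · refine ⟨w0 / v 0, by field_simp, ?_⟩
        field_simp
        linear_combination h
    have hX := Matrix.exists_mulVec_eq_zero_iff.1 ⟨v, hv0, show
        ((ρ a : Matrix (Fin 2) (Fin 2) K) * ρ b - ρ b * ρ a).mulVec v = 0 by
      funext i
      fin_cases i <;>
      simp only [Matrix.mulVec, dotProduct, Matrix.sub_apply, Matrix.mul_apply, Fin.sum_univ_two,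
        Fin.mk_zero, Fin.mk_one, Pi.zero_apply] <;> grind⟩
    rw [Matrix.det_fin_two] at hX
    simp only [Matrix.sub_apply, Matrix.mul_apply, Fin.sum_univ_two] at hX
    grind
  -- Scaling v and w by s gives the change of basis determinant 1.
  obtain ⟨s, hs⟩ := IsAlgClosed.exists_eq_mul_self (v 0 * w1 - w0 * v 1)⁻¹
  have hs1 : s * s * (v 0 * w1 - w0 * v 1) = 1 := by rw [← hs, inv_mul_cancel₀ hdet]
  let P : SL(2, K) := ⟨!![s * w1, -(s * w0); -(s * v 1), s * v 0], by
    rw [Matrix.det_fin_two_of]; linear_combination hs1⟩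
  have hP : (P : Matrix (Fin 2) (Fin 2) K) = !![s * w1, -(s * w0); -(s * v 1), s * v 0] := rfl
  have hP' : ((P⁻¹ : SL(2, K)) : Matrix (Fin 2) (Fin 2) K) =
      !![s * v 0, s * w0; s * v 1, s * w1] := by
    rw [Matrix.SpecialLinearGroup.coe_inv, hP, Matrix.adjugate_fin_two_of]
    simp
  refine ⟨P, ?_, ?_, ?_, ?_, ?_⟩
  · simp only [coe_conjRep, hP, hP', Matrix.mul_apply, Fin.sum_univ_two, Matrix.of_apply,
      Matrix.cons_val', Matrix.cons_val_zero, Matrix.cons_val_one, Matrix.cons_val_fin_one]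
    ring
  · simp only [coe_conjRep, hP, hP', Matrix.mul_apply, Fin.sum_univ_two, Matrix.of_apply,
      Matrix.cons_val', Matrix.cons_val_zero, Matrix.cons_val_one, Matrix.cons_val_fin_one]
    linear_combination (-1) * hs1 - s^2*(v 0 * w1 - w0 * v 1) * hA
  · simp only [coe_conjRep, hP, hP', Matrix.mul_apply, Fin.sum_univ_two, Matrix.of_apply,
      Matrix.cons_val', Matrix.cons_val_zero, Matrix.cons_val_one, Matrix.cons_val_fin_one]
    linear_combination hs1
  · simp only [coe_conjRep, hP, hP', Matrix.mul_apply, Fin.sum_univ_two, Matrix.of_apply,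
      Matrix.cons_val', Matrix.cons_val_zero, Matrix.cons_val_one, Matrix.cons_val_fin_one]
    linear_combination s^2 * v 0 * e1 - s^2 * v 1 * e0
  · have : nineTraces (conjRep P ρ) = nineTraces ρ :=
      funext fun i => congrFun (character_conjRep P ρ) (nine i)
    rwa [this]

/-! ### Recovering and realizing matrices from traces. -/

/-- For C with entries p, q, r, s, the values c, x, y, z, k are the traces of C, AC, BC, ABC, AB.
Eliminating p and q leaves two linear equations in r and s, with right-hand sides y - μc and z - μx
and determinant δ. The last identity is Fricke's relation for tr (ABC). -/
theorem cramer_trace {p q r s A μ ν m : K} (hμ : μ * m = 1) (hC : p * s - q * r = 1) :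
    let δ := A ^ 2 + (μ + m) ^ 2 + (ν + A * m) ^ 2 - A * (μ + m) * (ν + A * m) - 4
    let c := p + s
    let x := -r + q + A * s
    let y := μ * p + ν * r + m * s
    let z := μ * q - m * r + (ν + A * m) * s
    let k := ν + A * m
    δ * r = (ν + A * (m - μ)) * (y - μ * c) - (m - μ) * (z - μ * x) ∧
    δ * s = ν * (z - μ * x) - (μ - m) * (y - μ * c) ∧
    z ^ 2 - (A * y + (μ + m) * x + c * k - A * (μ + m) * c) * z +
      (A ^ 2 + (μ + m) ^ 2 + c ^ 2 + k ^ 2 + x ^ 2 + y ^ 2 - A * (μ + m) * k - A * c * x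
        - (μ + m) * c * y + k * y * x - 4) = 0 := by
  intro δ c x y z k
  refine ⟨?_, ?_, ?_⟩
  · grind
  · grind
  · grind

/-- The three trace conditions are linear and cut out a line of matrices; det = 1 is then a
quadratic equation on this line, solvable because δ ≠ 0. -/
theorem exists_matrix_of_traces [IsAlgClosed K] {A μ ν m : K} (hμ : μ * m = 1)
    (hδ : A ^ 2 + (μ + m) ^ 2 + (ν + A * m) ^ 2 - A * (μ + m) * (ν + A * m) - 4 ≠ 0) (c x y : K) :
    ∃ g : SL(2, K), g 0 0 + g 1 1 = c ∧ -g 1 0 + g 0 1 + A * g 1 1 = x ∧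
      μ * g 0 0 + ν * g 1 0 + m * g 1 1 = y := by
  suffices ∃ p q r s : K, p * s - q * r = 1 ∧ p + s = c ∧ -r + q + A * s = x ∧
      μ * p + ν * r + m * s = y by
    obtain ⟨p, q, r, s, h, hc, hx, hy⟩ := this
    exact ⟨⟨!![p, q; r, s], by rw [Matrix.det_fin_two_of, h]⟩, by simpa using hc,
      by simpa using hx, by simpa using hy⟩
  -- This is δ rewritten with μm = 1. For ν ≠ 0 it is the leading coefficient of the quadratic in s;
  -- for ν = 0 it forces m ≠ μ, which fixes s and leaves a monic quadratic in r.
  have hδ' : ν * (ν + A * (m - μ)) + (μ - m) ^ 2 ≠ 0 := fun h => hδ (by grind)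
  by_cases hν : ν = 0
  · have hm : m - μ ≠ 0 := fun h => hδ' (by rw [hν]; linear_combination (m - μ) * h)
    obtain ⟨s, hs⟩ : ∃ s, (m - μ) * s = y - μ * c := ⟨_, mul_div_cancel₀ _ hm⟩
    obtain ⟨r, hr⟩ := exists_quadratic_root (one_ne_zero (α := K)) (x - A * s)
      (1 - (c - s) * s)
    exact ⟨c - s, x + r - A * s, r, s, by linear_combination -hr, by ring, by ring,
      by rw [hν]; linear_combination hs⟩
  · obtain ⟨s, hs⟩ := exists_quadratic_root hδ'
      (-(c * ν ^ 2) + 2 * (y - μ * c) * (μ - m) + x * ν * (μ - m) - A * ν * (y - μ * c))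
      (ν ^ 2 + x * ν * (y - μ * c) + (y - μ * c) ^ 2)
    refine ⟨c - s, x + (y - μ * c + (μ - m) * s) / ν - A * s, (y - μ * c + (μ - m) * s) / ν, s,
      ?_, by ring, by ring, ?_⟩
    · field_simp
      linear_combination -hs
    · field_simp
      ring

theorem exists_normalRep [IsAlgClosed K] (t : Fin 9 → K) (ht : eval t (discr K) ≠ 0) :
    ∃ ρ : NormalRep K, nineTraces ρ.1 = t := by
  obtain ⟨μ, hμ⟩ := exists_quadratic_root (one_ne_zero (α := K)) (-t 1) 1
  have hμm : μ * (t 1 - μ) = 1 := by linear_combination -hμ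
  have hδ : t 0 ^ 2 + (μ + (t 1 - μ)) ^ 2 + (t 4 - t 0 * (t 1 - μ) + t 0 * (t 1 - μ)) ^ 2 -
      t 0 * (μ + (t 1 - μ)) * (t 4 - t 0 * (t 1 - μ) + t 0 * (t 1 - μ)) - 4 ≠ 0 := by
    rw [eval_discr] at ht
    ring_nf at ht ⊢
    exact ht
  obtain ⟨C, hC⟩ := exists_matrix_of_traces hμm hδ (t 2) (t 5) (t 6)
  obtain ⟨D, hD⟩ := exists_matrix_of_traces hμm hδ (t 3) (t 7) (t 8)
  let A : SL(2, K) := ⟨!![0, -1; 1, t 0], by simp [Matrix.det_fin_two_of]⟩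
  let B : SL(2, K) := ⟨!![μ, t 4 - t 0 * (t 1 - μ); 0, t 1 - μ], by
    rw [Matrix.det_fin_two_of]; linear_combination hμm⟩
  let ρ : Rep (FreeGroup (Fin 4)) K := FreeGroup.lift ![A, B, C, D]
  have ha : ρ a = A := by simp [ρ, a]
  have hb : ρ b = B := by simp [ρ, b]
  have hc : ρ c = C := by simp [ρ, c]
  have hd : ρ d = D := by simp [ρ, d]
  have hρ : nineTraces ρ = t := by
    obtain ⟨h0, h1, h2, h3, h4, h5, h6, h7, h8⟩ := nineTraces_apply ρ
    simp only [ha, hb, hc, hd, A, B, Matrix.of_apply, Matrix.cons_val', Matrix.cons_val_zero,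
      Matrix.cons_val_one, Matrix.cons_val_fin_one] at h0 h1 h2 h3 h4 h5 h6 h7 h8
    funext i
    fin_cases i
    · change nineTraces ρ 0 = t 0
      exact h0.trans (by ring)
    · change nineTraces ρ 1 = t 1
      exact h1.trans (by ring)
    · change nineTraces ρ 2 = t 2
      exact h2.trans hC.1
    · change nineTraces ρ 3 = t 3
      exact h3.trans hD.1
    · change nineTraces ρ 4 = t 4
      exact h4.trans (by ring)
    · change nineTraces ρ 5 = t 5
      exact h5.trans (by linear_combination hC.2.1)
    · change nineTraces ρ 6 = t 6
      exact h6.trans (by linear_combination hC.2.2)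
    · change nineTraces ρ 7 = t 7
      exact h7.trans (by linear_combination hD.2.1)
    · change nineTraces ρ 8 = t 8
      exact h8.trans (by linear_combination hD.2.2)
  exact ⟨⟨ρ, by rw [ha]; rfl, by rw [ha]; rfl, by rw [ha]; rfl, by rw [hb]; rfl, by rwa [hρ]⟩, hρ⟩

/-! ### Algebraic independence. -/

theorem aeval_function_apply {σ X : Type*} (f : σ → X → K) (p : MvPolynomial σ K) (x : X) :
    aeval f p x = eval (fun i => f i x) p := by
  induction p using MvPolynomial.induction_on <;> simp_all

theorem algebraicIndependent_nineTraces [IsAlgClosed K] :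
    AlgebraicIndependent K (fun i (ρ : NormalRep K) => nineTraces ρ.1 i) := by
  rw [algebraicIndependent_iff]
  intro p hp
  refine (mul_eq_zero.1 (?_ : p * discr K = 0)).resolve_right discr_ne_zero
  refine MvPolynomial.funext fun t => ?_
  rw [map_mul, map_zero]
  by_cases ht : eval t (discr K) = 0
  · rw [ht, mul_zero]
  · obtain ⟨ρ, rfl⟩ := exists_normalRep t ht
    have h := congrFun hp ρ
    rw [aeval_function_apply] at h
    rw [show eval (nineTraces ρ.1) p = 0 from h, zero_mul]

/-! ### Algebraicity on normal representations. -/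

/-- Polynomials in the nine traces act on the functions on the normal representations. -/
noncomputable instance normalRepAlgebra :
    Algebra (MvPolynomial (Fin 9) K) (NormalRep K → K) :=
  (RingHom.pi fun ρ : NormalRep K => eval (nineTraces ρ.1)).toAlgebra

theorem algebraMap_normalRep (p : MvPolynomial (Fin 9) K) (ρ : NormalRep K) :
    algebraMap (MvPolynomial (Fin 9) K) (NormalRep K → K) p ρ = eval (nineTraces ρ.1) p := rfl

def traceFn (K : Type*) [Field K] (k : Fin 9) : NormalRep K → K :=
  fun ρ => nineTraces ρ.1 k

theorem algebraMap_X (k : Fin 9) :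
    algebraMap (MvPolynomial (Fin 9) K) (NormalRep K → K) (X k) = traceFn K k :=
  _root_.funext fun ρ => by simp [algebraMap_normalRep, traceFn]

theorem isAlgebraic_traceFn (k : Fin 9) : IsAlgebraic (MvPolynomial (Fin 9) K) (traceFn K k) :=
  algebraMap_X (K := K) k ▸ isAlgebraic_algebraMap _

def entry (K : Type*) [Field K] (g : FreeGroup (Fin 4)) (i j : Fin 2) : NormalRep K → K :=
  fun ρ => ρ.1 g i j

theorem isAlgebraic_of_quadratic {R E : Type*} [CommRing R] [IsDomain R] [CommRing E] [Algebra R E]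
    {z : E} (β γ : R) (h : z ^ 2 - algebraMap R E β * z + algebraMap R E γ = 0) :
    IsAlgebraic R z := by
  refine ⟨.C 1 * .X ^ 2 + .C (-β) * .X + .C γ, fun h0 => ?_, ?_⟩
  · have := Polynomial.degree_quadratic (b := -β) (c := γ) (one_ne_zero (α := R))
    rw [h0] at this
    simp at this
  · simp only [map_add, map_mul, map_pow, Polynomial.aeval_C, Polynomial.aeval_X, map_neg, map_one]
    linear_combination h

theorem IsNormal.entries {ρ : Rep (FreeGroup (Fin 4)) K} (h : IsNormal ρ) :
    ρ a 1 1 = nineTraces ρ 0 ∧ ρ b 1 1 = nineTraces ρ 1 - ρ b 0 0 ∧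
    ρ b 0 1 = nineTraces ρ 4 - nineTraces ρ 0 * ρ b 1 1 ∧ ρ b 0 0 * ρ b 1 1 = 1 := by
  obtain ⟨h0, h1, -, -, h4, -⟩ := nineTraces_apply ρ
  have hB := det_entries (ρ b)
  rw [h0, h1, h4, h.a00, h.a01, h.a10, h.b10]
  rw [h.b10] at hB
  refine ⟨?_, ?_, ?_, ?_⟩ <;> grind

theorem isAlgebraic_entry_a (i j : Fin 2) :
    IsAlgebraic (MvPolynomial (Fin 9) K) (entry K a i j) := by
  have h : ∀ p, (∀ ρ : NormalRep K, ρ.1 a i j = eval (nineTraces ρ.1) p) →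
      IsAlgebraic (MvPolynomial (Fin 9) K) (entry K a i j) := fun p hp => by
    rw [show entry K a i j = algebraMap _ _ p from _root_.funext hp]
    exact isAlgebraic_algebraMap p
  fin_cases i <;> fin_cases j
  · exact h 0 fun ρ => by simp [ρ.2.a00]
  · exact h (-1) fun ρ => by simp [ρ.2.a01]
  · exact h 1 fun ρ => by simp [ρ.2.a10]
  · exact h (X 0) fun ρ => by simp [ρ.2.entries.1]

theorem isAlgebraic_entry_b (i j : Fin 2) :
    IsAlgebraic (MvPolynomial (Fin 9) K) (entry K b i j) := by
  have h00 : IsAlgebraic (MvPolynomial (Fin 9) K) (entry K b 0 0) := by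
    refine isAlgebraic_of_quadratic (X 1) 1 (_root_.funext fun ρ => ?_)
    obtain ⟨-, h1, -, h2⟩ := ρ.2.entries
    simp only [Pi.add_apply, Pi.sub_apply, Pi.mul_apply, Pi.pow_apply, Pi.zero_apply, entry,
      algebraMap_X, traceFn, map_one, Pi.one_apply]
    grind
  have h11 : IsAlgebraic (MvPolynomial (Fin 9) K) (entry K b 1 1) := by
    rw [show entry K b 1 1 = traceFn K 1 - entry K b 0 0 from
      _root_.funext fun ρ => by simpa [traceFn, entry] using ρ.2.entries.2.1]
    exact (isAlgebraic_traceFn (K := K) 1).sub h00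
  fin_cases i <;> fin_cases j
  · exact h00
  · change IsAlgebraic _ (entry K b 0 1)
    rw [show entry K b 0 1 = traceFn K 4 - traceFn K 0 * entry K b 1 1 from
      _root_.funext fun ρ => by simpa [traceFn, entry] using ρ.2.entries.2.2.1]
    exact (isAlgebraic_traceFn (K := K) 4).sub ((isAlgebraic_traceFn (K := K) 0).mul h11)
  · change IsAlgebraic _ (entry K b 1 0)
    rw [show entry K b 1 0 = 0 from _root_.funext fun ρ => ρ.2.b10]
    exact isAlgebraic_zero
  · exact h11

/-- A matrix whose products with the normalized `A, B` have traces among the nine has algebraic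
entries. -/
theorem isAlgebraic_entry_of_traces (g : FreeGroup (Fin 4)) (k₁ k₂ k₃ : Fin 9)
    (h₁ : ∀ ρ : NormalRep K, nineTraces ρ.1 k₁ = ρ.1 g 0 0 + ρ.1 g 1 1)
    (h₂ : ∀ ρ : NormalRep K, nineTraces ρ.1 k₂ =
      -ρ.1 g 1 0 + ρ.1 g 0 1 + nineTraces ρ.1 0 * ρ.1 g 1 1)
    (h₃ : ∀ ρ : NormalRep K, nineTraces ρ.1 k₃ =
      ρ.1 b 0 0 * ρ.1 g 0 0 + ρ.1 b 0 1 * ρ.1 g 1 0 + ρ.1 b 1 1 * ρ.1 g 1 1) (i j : Fin 2) :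
    IsAlgebraic (MvPolynomial (Fin 9) K) (entry K g i j) := by
  have hXa := isAlgebraic_traceFn (K := K)
  -- `z` is the trace of `a * b * g`, which need not be among the nine; `k₁`, `k₂`, `k₃` index the
  -- traces of `g`, `a * g`, `b * g`.
  set z : NormalRep K → K := entry K b 0 0 * entry K g 0 1 - entry K b 1 1 * entry K g 1 0 +
    (entry K b 0 1 + traceFn K 0 * entry K b 1 1) * entry K g 1 1 with hz
  have key (ρ : NormalRep K) := cramer_trace (A := nineTraces ρ.1 0) (ν := ρ.1 b 0 1)
    ρ.2.entries.2.2.2 (det_entries (ρ.1 g))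
  simp only [← h₁, ← h₂, ← h₃] at key
  have hb1 (ρ : NormalRep K) : ρ.1 b 0 0 + ρ.1 b 1 1 = nineTraces ρ.1 1 := by
    rw [ρ.2.entries.2.1]; ring
  have hab (ρ : NormalRep K) : ρ.1 b 0 1 + nineTraces ρ.1 0 * ρ.1 b 1 1 = nineTraces ρ.1 4 := by
    rw [ρ.2.entries.2.2.1]; ring
  have hzρ (ρ : NormalRep K) : ρ.1 b 0 0 * ρ.1 g 0 1 - ρ.1 b 1 1 * ρ.1 g 1 0 +
      nineTraces ρ.1 4 * ρ.1 g 1 1 = z ρ := by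
    simp only [hz, Pi.add_apply, Pi.sub_apply, Pi.mul_apply, entry, traceFn, hab]
  simp only [hb1, hab, hzρ] at key
  have hza : IsAlgebraic (MvPolynomial (Fin 9) K) z := by
    refine isAlgebraic_of_quadratic
      (X 0 * X k₃ + X 1 * X k₂ + X k₁ * X 4 - X 0 * X 1 * X k₁)
      (X 0 ^ 2 + X 1 ^ 2 + X k₁ ^ 2 + X 4 ^ 2 + X k₂ ^ 2 + X k₃ ^ 2 - X 0 * X 1 * X 4 -
        X 0 * X k₁ * X k₂ - X 1 * X k₁ * X k₃ + X 4 * X k₃ * X k₂ - 4)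
      (_root_.funext fun ρ => ?_)
    have := (key ρ).2.2
    simp only [Pi.add_apply, Pi.sub_apply, Pi.mul_apply, Pi.pow_apply,
      map_add, map_sub, map_mul, map_pow, map_ofNat, algebraMap_X, traceFn, Pi.ofNat_apply]
    linear_combination this
  -- Cramer's rule yields only δ times an entry; cancelling the nonzero δ preserves algebraicity.
  have hsmul (u v : NormalRep K → K) (hv : IsAlgebraic (MvPolynomial (Fin 9) K) v)
      (huv : ∀ ρ : NormalRep K, eval (nineTraces ρ.1) (discr K) * u ρ = v ρ) :
      IsAlgebraic (MvPolynomial (Fin 9) K) u := by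
    refine IsAlgebraic.of_smul (mem_nonZeroDivisors_of_ne_zero (discr_ne_zero (K := K))) ?_
    rwa [Algebra.smul_def, show algebraMap (MvPolynomial (Fin 9) K) _ (discr K) * u = v from
      _root_.funext huv]
  have hb := isAlgebraic_entry_b (K := K)
  have h10 : IsAlgebraic (MvPolynomial (Fin 9) K) (entry K g 1 0) := by
    refine hsmul _ ((entry K b 0 1 + traceFn K 0 * (entry K b 1 1 - entry K b 0 0)) *
        (traceFn K k₃ - entry K b 0 0 * traceFn K k₁) -
      (entry K b 1 1 - entry K b 0 0) * (z - entry K b 0 0 * traceFn K k₂)) ?_ fun ρ => ?_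
    · exact (((hb 0 1).add ((hXa 0).mul ((hb 1 1).sub (hb 0 0)))).mul
        ((hXa k₃).sub ((hb 0 0).mul (hXa k₁)))).sub
        (((hb 1 1).sub (hb 0 0)).mul (hza.sub ((hb 0 0).mul (hXa k₂))))
    · rw [eval_discr]
      simp only [Pi.add_apply, Pi.sub_apply, Pi.mul_apply, traceFn, entry]
      exact (key ρ).1
  have h11 : IsAlgebraic (MvPolynomial (Fin 9) K) (entry K g 1 1) := by
    refine hsmul _ (entry K b 0 1 * (z - entry K b 0 0 * traceFn K k₂) -
      (entry K b 0 0 - entry K b 1 1) *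
        (traceFn K k₃ - entry K b 0 0 * traceFn K k₁)) ?_ fun ρ => ?_
    · exact ((hb 0 1).mul (hza.sub ((hb 0 0).mul (hXa k₂)))).sub
        (((hb 0 0).sub (hb 1 1)).mul ((hXa k₃).sub ((hb 0 0).mul (hXa k₁))))
    · rw [eval_discr]
      simp only [Pi.sub_apply, Pi.mul_apply, traceFn, entry]
      exact (key ρ).2.1
  fin_cases i <;> fin_cases j
  · change IsAlgebraic _ (entry K g 0 0)
    rw [show entry K g 0 0 = traceFn K k₁ - entry K g 1 1 from
      _root_.funext fun ρ => by simp [traceFn, entry, h₁]]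
    exact (hXa k₁).sub h11
  · change IsAlgebraic _ (entry K g 0 1)
    rw [show entry K g 0 1 = traceFn K k₂ + entry K g 1 0 -
        traceFn K 0 * entry K g 1 1 from
      _root_.funext fun ρ => by simp [traceFn, entry, h₂]; ring]
    exact ((hXa k₂).add h10).sub ((hXa 0).mul h11)
  · exact h10
  · exact h11

theorem isAlgebraic_entry (g : FreeGroup (Fin 4)) :
    ∀ i j, IsAlgebraic (MvPolynomial (Fin 9) K) (entry K g i j) := by
  have hmul (g h : FreeGroup (Fin 4)) (i j : Fin 2) :
      entry K (g * h) i j = entry K g i 0 * entry K h 0 j + entry K g i 1 * entry K h 1 j :=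
    _root_.funext fun ρ => by simp [entry, Matrix.mul_apply, Fin.sum_univ_two]
  induction g using FreeGroup.induction_on with
  | C1 =>
    intro i j
    rw [show entry K 1 i j = algebraMap (MvPolynomial (Fin 9) K) _ (if i = j then 1 else 0) from
        _root_.funext fun ρ => by
      rw [algebraMap_normalRep]; split_ifs with h <;> simp [entry, h]]
    exact isAlgebraic_algebraMap _
  | of x =>
    fin_cases x
    · exact isAlgebraic_entry_a
    · exact isAlgebraic_entry_b
    · refine isAlgebraic_entry_of_traces c 2 5 6 (fun ρ => ?_) (fun ρ => ?_) fun ρ => ?_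
      · exact (nineTraces_apply ρ.1).2.2.1
      · rw [(nineTraces_apply ρ.1).2.2.2.2.2.1, ρ.2.entries.1, ρ.2.a00, ρ.2.a01, ρ.2.a10]; ring
      · rw [(nineTraces_apply ρ.1).2.2.2.2.2.2.1, ρ.2.b10]; ring
    · refine isAlgebraic_entry_of_traces d 3 7 8 (fun ρ => ?_) (fun ρ => ?_) fun ρ => ?_
      · exact (nineTraces_apply ρ.1).2.2.2.1
      · rw [(nineTraces_apply ρ.1).2.2.2.2.2.2.2.1, ρ.2.entries.1, ρ.2.a00, ρ.2.a01, ρ.2.a10]; ring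
      · rw [(nineTraces_apply ρ.1).2.2.2.2.2.2.2.2, ρ.2.b10]; ring
  | inv_of x hx =>
    have hinv (g : FreeGroup (Fin 4)) (ρ : NormalRep K) : (ρ.1 g⁻¹ : Matrix (Fin 2) (Fin 2) K) =
        !![ρ.1 g 1 1, -ρ.1 g 0 1; -ρ.1 g 1 0, ρ.1 g 0 0] := by
      rw [map_inv, Matrix.SpecialLinearGroup.coe_inv, Matrix.adjugate_fin_two]
    intro i j
    fin_cases i <;> fin_cases j
    · convert hx 1 1 using 1
      exact _root_.funext fun ρ => congrFun (congrFun (hinv _ ρ) 0) 0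
    · convert (hx 0 1).neg using 1
      exact _root_.funext fun ρ => congrFun (congrFun (hinv _ ρ) 0) 1
    · convert (hx 1 0).neg using 1
      exact _root_.funext fun ρ => congrFun (congrFun (hinv _ ρ) 1) 0
    · convert hx 0 0 using 1
      exact _root_.funext fun ρ => congrFun (congrFun (hinv _ ρ) 1) 1
  | mul g h hg hh =>
    intro i j
    rw [hmul]
    exact ((hg _ _).mul (hh _ _)).add ((hg _ _).mul (hh _ _))

/-! ### From normal representations to the two coordinate rings. -/

theorem isAlgebraic_of_mem_repRing {f : Rep (FreeGroup (Fin 4)) K → K}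
    (hf : f ∈ repRing (FreeGroup (Fin 4)) K) :
    IsAlgebraic (MvPolynomial (Fin 9) K) (fun ρ : NormalRep K => f ρ.1) := by
  induction hf using Algebra.adjoin_induction with
  | mem f hf => obtain ⟨⟨g, i, j⟩, rfl⟩ := hf; exact isAlgebraic_entry g i j
  | algebraMap r =>
    rw [show (fun ρ : NormalRep K => algebraMap K (Rep (FreeGroup (Fin 4)) K → K) r ρ.1) =
      algebraMap (MvPolynomial (Fin 9) K) _ (C r) from
        _root_.funext fun ρ => by rw [algebraMap_normalRep, eval_C]; rfl]
    exact isAlgebraic_algebraMap _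
  | add f g _ _ hf hg => exact hf.add hg
  | mul f g _ _ hf hg => exact hf.mul hg

/-- If the kernel of a homomorphism to the functions on the normal representations is killed by
the discriminant, then algebraicity can be tested on normal representations. -/
theorem isAlgebraic_adjoin_of_restrict [IsAlgClosed K] {E : Type*} [CommRing E] [Algebra K E]
    (t : Fin 9 → E) (ψ : E →ₐ[K] (NormalRep K → K)) (hψ : ∀ i, ψ (t i) = traceFn K i)
    (hker : ∀ x, ψ x = 0 → aeval t (discr K) * x = 0)
    (halg : ∀ x, IsAlgebraic (MvPolynomial (Fin 9) K) (ψ x)) :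
    AlgebraicIndependent K t ∧
      Algebra.IsAlgebraic (Algebra.adjoin K (Set.range t)) E := by
  have hind : AlgebraicIndependent K t := by
    refine AlgebraicIndependent.of_comp ψ ?_
    rw [show ψ ∘ t = fun i => traceFn K i from _root_.funext hψ]
    exact algebraicIndependent_nineTraces
  refine ⟨hind, ⟨fun x => ?_⟩⟩
  let _ : Algebra (MvPolynomial (Fin 9) K) E := (aeval t).toAlgebra
  have hcomp : (ψ : E →+* (NormalRep K → K)).comp (algebraMap (MvPolynomial (Fin 9) K) E) =
      algebraMap (MvPolynomial (Fin 9) K) (NormalRep K → K) := by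
    ext p ρ
    · change ψ (aeval t (C p)) ρ = eval (nineTraces ρ.1) (C p)
      simp
    · change ψ (aeval t (X p)) ρ = eval (nineTraces ρ.1) (X p)
      rw [aeval_X, hψ, eval_X]
      rfl
  have hx : IsAlgebraic (MvPolynomial (Fin 9) K) x := by
    obtain ⟨q, hq0, hq⟩ := halg x
    refine ⟨.C (discr K) * q, mul_ne_zero (Polynomial.C_ne_zero.2 discr_ne_zero) hq0, ?_⟩
    rw [map_mul, Polynomial.aeval_C]
    refine hker _ ?_
    rw [Polynomial.aeval_def, ← hcomp] at hq
    rw [Polynomial.aeval_def]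
    exact (Polynomial.hom_eval₂ q _ (ψ : E →+* (NormalRep K → K)) x).trans hq
  -- By independence the polynomial ring is isomorphic to the subalgebra generated by `t`, so
  -- algebraicity transfers.
  refine IsAlgebraic.of_ringHom_of_comp_eq (f := (hind.repr : _ →+* MvPolynomial (Fin 9) K))
    (g := RingHom.id E) hx (fun p => ⟨hind.aevalEquiv p, hind.aevalEquiv.symm_apply_apply p⟩)
    Function.injective_id (RingHom.ext fun p => hind.aeval_repr p)

theorem comp_character_mem_repRing {Γ : Type*} [Group Γ] {f : charVariety Γ K → K}
    (hf : f ∈ coordRing Γ K) : (fun ρ : Rep Γ K => f ⟨character ρ, ρ, rfl⟩) ∈ repRing Γ K := by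
  induction hf using Algebra.adjoin_induction with
  | mem f hf => obtain ⟨g, rfl⟩ := hf; exact (character_mem_invRing K g).1
  | algebraMap r => exact (repRing Γ K).algebraMap_mem r
  | add f g _ _ hf hg => exact add_mem hf hg
  | mul f g _ _ hf hg => exact mul_mem hf hg

/-- Pullback of functions along a map of sets. -/
def pullback {X Y : Type*} (f : Y → X) : (X → K) →ₐ[K] (Y → K) where
  toFun u := u ∘ f
  map_one' := rfl
  map_mul' _ _ := rfl
  map_zero' := rfl
  map_add' _ _ := rfl
  commutes' _ := rfl

/-- A function vanishing on normal characters vanishes wherever δ ≠ 0, since conjugation to normal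
form keeps the character; elsewhere the factor δ is zero. -/
theorem nine_transcendental_generators_coordRing (K : Type*) [Field K] [IsAlgClosed K] :
    AlgebraicIndependent K (fun i => tr K (nine i)) ∧
      Algebra.IsAlgebraic (Algebra.adjoin K (Set.range fun i => tr K (nine i)))
        (coordRing (FreeGroup (Fin 4)) K) := by
  refine isAlgebraic_adjoin_of_restrict _
    ((pullback fun ρ : NormalRep K => (⟨character ρ.1, ρ.1, rfl⟩ : charVariety _ K)).comp
      (coordRing _ K).val)
    (fun i => rfl) (fun x hx => ?_)
    fun x => isAlgebraic_of_mem_repRing (comp_character_mem_repRing x.2)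
  rw [aeval_discr]
  refine Subtype.ext (_root_.funext fun χ => ?_)
  obtain ⟨χ, ρ, rfl⟩ := χ
  change (nineTraces ρ 0 ^ 2 + nineTraces ρ 1 ^ 2 + nineTraces ρ 4 ^ 2 -
    nineTraces ρ 0 * nineTraces ρ 1 * nineTraces ρ 4 - 4) * x.1 ⟨character ρ, _⟩ = 0
  rw [← eval_discr]
  by_cases hρ : eval (nineTraces ρ) (discr K) = 0
  · rw [hρ, zero_mul]
  · obtain ⟨P, hP⟩ := exists_conjRep_isNormal ρ hρ
    have h : x.1 ⟨character (conjRep P ρ), conjRep P ρ, rfl⟩ = 0 := congrFun hx ⟨_, hP⟩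
    simp only [character_conjRep] at h
    rw [h, mul_zero]

/-- Here conjugation invariance of the function itself takes the place of invariance of the
character. -/
theorem nine_transcendental_generators_invRing (K : Type*) [Field K] [IsAlgClosed K] :
    AlgebraicIndependent K (fun i => trInv K (nine i)) ∧
      Algebra.IsAlgebraic (Algebra.adjoin K (Set.range fun i => trInv K (nine i)))
        (invRing (FreeGroup (Fin 4)) K) := by
  refine isAlgebraic_adjoin_of_restrict _
    ((pullback fun ρ : NormalRep K => ρ.1).comp (invRing _ K).val)
    (fun i => rfl) (fun x hx => ?_) fun x => isAlgebraic_of_mem_repRing x.2.1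
  rw [aeval_discr]
  refine Subtype.ext (_root_.funext fun ρ => ?_)
  change (nineTraces ρ 0 ^ 2 + nineTraces ρ 1 ^ 2 + nineTraces ρ 4 ^ 2 -
    nineTraces ρ 0 * nineTraces ρ 1 * nineTraces ρ 4 - 4) * x.1 ρ = 0
  rw [← eval_discr]
  by_cases hρ : eval (nineTraces ρ) (discr K) = 0
  · rw [hρ, zero_mul]
  · obtain ⟨P, hP⟩ := exists_conjRep_isNormal ρ hρ
    have h : x.1 (conjRep P ρ) = 0 := congrFun hx ⟨_, hP⟩
    rw [← x.2.2 P ρ, h, mul_zero]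

end SL2CharVar

theorem propositionp (K : Type*) [Field K] [IsAlgClosed K] :
    -- the character variety `X(F₄, SL₂)`, as the variety of characters
    (IsAlgebraic
        (Algebra.adjoin K (Set.range fun i => SL2CharVar.tr K (SL2CharVar.nine i)))
        (SL2CharVar.tr K (SL2CharVar.c * SL2CharVar.d)) ∧
      AlgebraicIndependent K (fun i => SL2CharVar.tr K (SL2CharVar.nine i)) ∧
      Algebra.IsAlgebraic
        (Algebra.adjoin K (Set.range fun i => SL2CharVar.tr K (SL2CharVar.nine i)))
        (SL2CharVar.coordRing (FreeGroup (Fin 4)) K)) ∧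
    -- the same in the GIT quotient `(SL₂)⁴ // SL₂`
    (IsAlgebraic
        (Algebra.adjoin K (Set.range fun i => SL2CharVar.trInv K (SL2CharVar.nine i)))
        (SL2CharVar.trInv K (SL2CharVar.c * SL2CharVar.d)) ∧
      AlgebraicIndependent K (fun i => SL2CharVar.trInv K (SL2CharVar.nine i)) ∧
      Algebra.IsAlgebraic
        (Algebra.adjoin K (Set.range fun i => SL2CharVar.trInv K (SL2CharVar.nine i)))
        (SL2CharVar.invRing (FreeGroup (Fin 4)) K)) := by
  obtain ⟨h₁, h₂⟩ := SL2CharVar.nine_transcendental_generators_coordRing K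
  obtain ⟨h₃, h₄⟩ := SL2CharVar.nine_transcendental_generators_invRing K
  exact ⟨⟨h₂.isAlgebraic _, h₁, h₂⟩, h₄.isAlgebraic _, h₃, h₄⟩
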